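/- Call a real symmetric infinite matrix $K=(K_{ij})_{i,j\in\mathbb N}$ a positive semidefinite kernel if $\sum_{i,j}c_ic_jK_{ij}\ge 0$ for every finitely supported real sequence $c$, and let $\mathcal H_K$ be the reproducing kernel Hilbert space of real sequences induced by $K$. Let $\ell_1$ be the space of absolutely summable real sequences. Consider the following classes of positive semidefinite kernels on $\mathbb N\times\mathbb N$: - $\mathcal S_1$, the absolutely summable kernels: $\sum_{i,j}|K_{ij}|<\infty$; - $\mathcal S_s$, the stable kernels: $\mathcal H_K\subset\ell_1$; - $\mathcal S_{ft}$, the finite-trace kernels: $\sum_i K_{ii}<\infty$; - $\mathcal S_2$, the square-summable kernels: $\sum_{i,j}K_{ij}^2<\infty$. Then $$\mathcal S_1\subsetneq\mathcal S_s\subsetneq\mathcal S_{ft}\subsetneq\mathcal S_2 .$$ In particular, every stable kernel has finite trace, and absolute summability of a kernel is sufficient but not necessary for its stability. -/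

import Mathlib

/-- Positive semidefinite kernels on `ℕ × ℕ`: real infinite matrices that are symmetric and whose
quadratic form on finitely supported sequences is nonnegative. -/
abbrev PSDKernel : Type := {K : Matrix ℕ ℕ ℝ // K.PosSemidef}

namespace PSDKernel

/-- The kernel with each real entry `K i j` regarded as the operator `c ↦ K i j * c` on `ℝ`, the
form in which Mathlib's (vector-valued) reproducing kernel Hilbert spaces take their kernels. -/
noncomputable def toOp (K : PSDKernel) : Matrix ℕ ℕ (ℝ →L[ℝ] ℝ) :=
  Matrix.of fun i j => K.1 i j • ContinuousLinearMap.id ℝ ℝ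

theorem toOp_posSemidef (K : PSDKernel) : K.toOp.PosSemidef := by
  have key := (RKHS.posSemidef_tfae (𝕜 := ℝ) (K := K.toOp)).out 0 2
  refine key.mpr (And.intro ?_ fun v => ?_)
  · ext i j
    have h := K.2.1.apply i j
    simp only [star_trivial] at h
    have hid : star (ContinuousLinearMap.id ℝ ℝ) = ContinuousLinearMap.id ℝ ℝ :=
      star_one (ℝ →L[ℝ] ℝ)
    simp [toOp, h, hid]
  · have h := K.2.2 v
    simp only [star_trivial] at h
    rw [Finsupp.sum_comm] at h
    simpa [toOp, mul_comm, mul_left_comm, mul_assoc] using h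

instance (K : PSDKernel) : Fact K.toOp.PosSemidef := ⟨K.toOp_posSemidef⟩

/-- The reproducing kernel Hilbert space `ℋ` of real sequences induced by the kernel `K`. -/
abbrev Space (K : PSDKernel) : Type := RKHS.OfKernel K.toOp

/-- The reproducing kernel of `K.Space` is `K`. -/
theorem kernel_space (K : PSDKernel) (i j : ℕ) : RKHS.kernel K.Space i j 1 = K.1 i j := by
  have h : RKHS.kernel K.Space = K.toOp := RKHS.OfKernel.kernel_ofKernel
  rw [h]
  simp [toOp]

/-- `𝒮₁`: the absolutely summable kernels, `∑ i j, |K i j| < ∞`. -/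
def absSummable : Set PSDKernel := {K | Summable fun p : ℕ × ℕ => |K.1 p.1 p.2|}

/-- `𝒮ₛ`: the stable kernels, those whose reproducing kernel Hilbert space is contained
in `ℓ₁`. -/
def stable : Set PSDKernel := {K | ∀ f : K.Space, Summable fun i : ℕ => |f i|}

/-- `𝒮_ft`: the finite-trace kernels, `∑ i, K i i < ∞`. -/
def finiteTrace : Set PSDKernel := {K | Summable fun i : ℕ => K.1 i i}

/-- `𝒮₂`: the square-summable kernels, `∑ i j, (K i j)² < ∞`. -/
def sqSummable : Set PSDKernel := {K | Summable fun p : ℕ × ℕ => K.1 p.1 p.2 ^ 2}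

end PSDKernel

/-! The sections k_i of K satisfy ⟪k_i, k_j⟫ = K i j, so the quadratic form at c is ‖∑ c_i k_i‖²,
and stability is controlled by sums with coefficients in [-1, 1]. Absolute summability bounds these
sums directly. Conversely, stability bounds them by Banach–Steinhaus, and a good choice of signs
makes them dominate the trace. Cauchy–Schwarz turns finite trace into square summability.

The last two inclusions are strict by a diagonal and a rank-one kernel. For the first, take the Gram
matrix of two weighted orthonormal bases related by Walsh–Hadamard blocks: each basis alone has
bounded signed sums, yet the cross entries all have equal size within a block and are not summable.
-/

open scoped InnerProductSpace

/-! ### Signed sums and Gram matrices -/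

/-- In any finite family of vectors, signs can be chosen so that the signed sum has squared norm
at least the sum of the squared norms. -/
theorem exists_signs_sum_norm_sq_le {E : Type*} [NormedAddCommGroup E] [InnerProductSpace ℝ E]
    (v : ℕ → E) (n : ℕ) :
    ∃ ε : ℕ → ℝ, (∀ i, |ε i| ≤ 1) ∧
      ∑ i ∈ Finset.range n, ‖v i‖ ^ 2 ≤ ‖∑ i ∈ Finset.range n, ε i • v i‖ ^ 2 := by
  induction n with
  | zero => exact ⟨0, by simp, by simp⟩
  | succ n ih =>
    obtain ⟨ε, hε, h⟩ := ih
    -- The new sign is chosen to make the cross term nonnegative.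
    have key : ∃ t : ℝ, |t| = 1 ∧ 0 ≤ t * ⟪∑ i ∈ Finset.range n, ε i • v i, v n⟫_ℝ := by
      rcases le_total 0 ⟪∑ i ∈ Finset.range n, ε i • v i, v n⟫_ℝ with h0 | h0
      · exact ⟨1, by simp, by simpa using h0⟩
      · exact ⟨-1, by simp, by simpa using h0⟩
    obtain ⟨t, ht, ht0⟩ := key
    refine ⟨Function.update ε n t, fun i => ?_, ?_⟩
    · rcases eq_or_ne i n with rfl | hi
      · simp [ht]
      · simpa [hi] using hε i
    · have hsum : ∑ i ∈ Finset.range n, Function.update ε n t i • v i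
          = ∑ i ∈ Finset.range n, ε i • v i :=
        Finset.sum_congr rfl fun i hi => by
          rw [Function.update_of_ne (Finset.mem_range.1 hi).ne]
      rw [Finset.sum_range_succ, Finset.sum_range_succ, hsum, Function.update_self,
        norm_add_sq_real, inner_smul_right, norm_smul, Real.norm_eq_abs, ht, one_mul]
      linarith

theorem norm_sum_smul_sq {ι E : Type*} [NormedAddCommGroup E] [InnerProductSpace ℝ E]
    (s : Finset ι) (c : ι → ℝ) (v : ι → E) :
    ‖∑ i ∈ s, c i • v i‖ ^ 2 = ∑ i ∈ s, ∑ j ∈ s, c i * c j * ⟪v i, v j⟫_ℝ := by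
  rw [← real_inner_self_eq_norm_sq, sum_inner]
  refine Finset.sum_congr rfl fun i _ => ?_
  rw [inner_sum]
  refine Finset.sum_congr rfl fun j _ => ?_
  rw [real_inner_smul_left, real_inner_smul_right, mul_assoc]

/-- Gram matrices of arbitrary families of vectors are positive semidefinite. -/
theorem posSemidef_gram_of_family {ι E : Type*} [NormedAddCommGroup E] [InnerProductSpace ℝ E]
    (v : ι → E) : (Matrix.gram ℝ v).PosSemidef := by
  refine ⟨Matrix.isHermitian_gram ℝ v, fun x => ?_⟩
  have h : (x.sum fun i xi => x.sum fun j xj => star xi * Matrix.gram ℝ v i j * xj)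
      = ‖∑ i ∈ x.support, x i • v i‖ ^ 2 := by
    simp only [Finsupp.sum, norm_sum_smul_sq, Matrix.gram_apply, star_trivial, mul_right_comm]
  rw [h]
  exact sq_nonneg _

theorem norm_sum_sq_of_pairwise_orthogonal {ι E : Type*} [NormedAddCommGroup E]
    [InnerProductSpace ℝ E] {a : ι → E} (ha : Pairwise fun i j => ⟪a i, a j⟫_ℝ = 0)
    (s : Finset ι) (c : ι → ℝ) :
    ‖∑ i ∈ s, c i • a i‖ ^ 2 = ∑ i ∈ s, c i ^ 2 * ‖a i‖ ^ 2 := by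
  rw [← real_inner_self_eq_norm_sq, sum_inner]
  refine Finset.sum_congr rfl fun i hi => ?_
  rw [inner_sum, Finset.sum_eq_single_of_mem i hi]
  · rw [real_inner_smul_left, real_inner_smul_right, real_inner_self_eq_norm_sq]
    ring
  · intro j _ hj
    rw [real_inner_smul_left, real_inner_smul_right, ha hj.symm]
    ring

/-! ### Kernel sections and the three inclusions -/

namespace PSDKernel

variable (K : PSDKernel)

/-- The kernel section `K (·, i)` as an element of the reproducing kernel Hilbert space. -/
noncomputable def kernelSection (i : ℕ) : K.Space := RKHS.kerFun K.Space i 1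

theorem kernelSection_apply (i j : ℕ) : K.kernelSection j i = K.1 i j := by
  rw [kernelSection, RKHS.kerFun_apply, kernel_space]

theorem inner_kernelSection (i : ℕ) (f : K.Space) : ⟪K.kernelSection i, f⟫_ℝ = f i := by
  rw [kernelSection, RKHS.kerFun_inner]
  simp

theorem inner_kernelSections (i j : ℕ) : ⟪K.kernelSection i, K.kernelSection j⟫_ℝ = K.1 i j := by
  rw [inner_kernelSection, kernelSection_apply]

theorem norm_kernelSection_sq (i : ℕ) : ‖K.kernelSection i‖ ^ 2 = K.1 i i := by
  rw [← real_inner_self_eq_norm_sq, inner_kernelSections]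

theorem norm_sum_kernelSection_sq (s : Finset ℕ) (c : ℕ → ℝ) :
    ‖∑ i ∈ s, c i • K.kernelSection i‖ ^ 2 = ∑ i ∈ s, ∑ j ∈ s, c i * c j * K.1 i j := by
  simp only [norm_sum_smul_sq, inner_kernelSections]

theorem diag_nonneg (i : ℕ) : 0 ≤ K.1 i i := K.norm_kernelSection_sq i ▸ sq_nonneg _

theorem sq_entry_le (i j : ℕ) : K.1 i j ^ 2 ≤ K.1 i i * K.1 j j := by
  rw [← inner_kernelSections, ← norm_kernelSection_sq, ← norm_kernelSection_sq, ← mul_pow, ← sq_abs]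
  exact pow_le_pow_left₀ (abs_nonneg _) (abs_real_inner_le_norm _ _) 2

variable {K}

/-- A kernel whose quadratic form is bounded on finitely supported sequences with entries in
`[-1, 1]` is stable. -/
theorem mem_stable_of_bound (C : ℝ)
    (h : ∀ (s : Finset ℕ) (ε : ℕ → ℝ), (∀ i, |ε i| ≤ 1) →
      ∑ i ∈ s, ∑ j ∈ s, ε i * ε j * K.1 i j ≤ C) : K ∈ stable := by
  intro f
  refine summable_of_sum_le (c := √C * ‖f‖) (fun _ => abs_nonneg _) fun s => ?_
  have hε : ∀ i, |(SignType.sign (f i) : ℝ)| ≤ 1 := fun i => by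
    rcases lt_trichotomy (f i) 0 with h | h | h <;> simp [h]
  have hb := h s (fun i => SignType.sign (f i)) hε
  rw [← norm_sum_kernelSection_sq] at hb
  -- Test f against the combination of sections carrying its own signs; Cauchy–Schwarz then gives
  -- the constant √C * ‖f‖.
  calc ∑ i ∈ s, |f i| = ⟪∑ i ∈ s, (SignType.sign (f i) : ℝ) • K.kernelSection i, f⟫_ℝ := by
        rw [sum_inner]
        refine Finset.sum_congr rfl fun i _ => ?_
        rw [real_inner_smul_left, inner_kernelSection, sign_mul_self]
    _ ≤ _ := real_inner_le_norm _ _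
    _ ≤ _ := mul_le_mul_of_nonneg_right (Real.le_sqrt_of_sq_le hb) (norm_nonneg _)

theorem absSummable_subset_stable : absSummable ⊆ stable := by
  intro K hK
  refine mem_stable_of_bound (∑' p : ℕ × ℕ, |K.1 p.1 p.2|) fun s ε hε => ?_
  rw [← Finset.sum_product']
  refine le_trans (Finset.sum_le_sum fun p _ => ?_)
    (Summable.sum_le_tsum (s ×ˢ s) (fun _ _ => abs_nonneg _) hK)
  refine (le_abs_self _).trans ?_
  rw [abs_mul, abs_mul]
  exact mul_le_of_le_one_left (abs_nonneg _) (mul_le_one₀ (hε _) (abs_nonneg _) (hε _))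

/-- The functionals f ↦ ∑ ε_i f_i are bounded pointwise by the ℓ₁ norm of f, hence uniformly in
norm; the best signs make that norm dominate the partial traces. -/
theorem stable_subset_finiteTrace : stable ⊆ finiteTrace := by
  intro K hK
  let g : {ε : ℕ → ℝ // ∀ i, |ε i| ≤ 1} × ℕ → K.Space →L[ℝ] ℝ := fun p =>
    innerSL ℝ (∑ i ∈ Finset.range p.2, p.1.1 i • K.kernelSection i)
  obtain ⟨C, hC⟩ : ∃ C, ∀ p, ‖g p‖ ≤ C := by
    refine banach_steinhaus fun f => ⟨∑' i, |f i|, fun p => ?_⟩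
    have hg : g p f = ∑ i ∈ Finset.range p.2, p.1.1 i * f i := by
      simp only [g, innerSL_apply_apply, sum_inner, real_inner_smul_left, inner_kernelSection]
    rw [hg, Real.norm_eq_abs]
    refine (Finset.abs_sum_le_sum_abs _ _).trans <| le_trans (Finset.sum_le_sum fun i _ => ?_)
      (Summable.sum_le_tsum _ (fun _ _ => abs_nonneg _) (hK f))
    rw [abs_mul]
    exact mul_le_of_le_one_left (abs_nonneg _) (p.1.2 i)
  refine summable_of_sum_range_le (c := C ^ 2) K.diag_nonneg fun n => ?_
  obtain ⟨ε, hε, h⟩ := exists_signs_sum_norm_sq_le K.kernelSection n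
  simp only [norm_kernelSection_sq] at h
  refine h.trans (pow_le_pow_left₀ (norm_nonneg _) ?_ 2)
  simpa only [g, innerSL_apply_norm] using hC (⟨ε, hε⟩, n)

theorem finiteTrace_subset_sqSummable : finiteTrace ⊆ sqSummable := by
  intro K hK
  exact Summable.of_nonneg_of_le (fun _ => sq_nonneg _) (fun p => K.sq_entry_le p.1 p.2)
    (Summable.mul_of_nonneg hK hK K.diag_nonneg K.diag_nonneg)

/-! ### Separating examples -/

theorem not_summable_inv_succ : ¬ Summable fun i : ℕ => ((i : ℝ) + 1)⁻¹ := by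
  have h := mt (summable_nat_add_iff (f := fun n : ℕ => 1 / (n : ℝ)) 1).1
    Real.not_summable_one_div_natCast
  simpa using h

theorem summable_inv_succ_sq : Summable fun i : ℕ => (((i : ℝ) + 1)⁻¹) ^ 2 := by
  have h := (summable_nat_add_iff (f := fun n : ℕ => 1 / (n : ℝ) ^ 2) 1).2
    (Real.summable_one_div_nat_pow.2 one_lt_two)
  simpa using h

theorem not_sqSummable_subset_finiteTrace : ¬ sqSummable ⊆ finiteTrace := by
  intro h
  have hpos : ∀ i : ℕ, 0 ≤ ((i : ℝ) + 1)⁻¹ := fun i => by positivity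
  let K : PSDKernel := ⟨Matrix.diagonal fun i => ((i : ℝ) + 1)⁻¹, .diagonal hpos⟩
  have hK : K ∈ sqSummable := by
    have hinj : Function.Injective fun i : ℕ => (i, i) := fun i j hij => (Prod.ext_iff.1 hij).1
    refine (hinj.summable_iff fun p hp => ?_).1 ?_
    · have hne : p.1 ≠ p.2 := fun he => hp ⟨p.1, Prod.ext rfl he⟩
      simp [K, hne]
    · simpa [K, Function.comp_def] using summable_inv_succ_sq
  exact not_summable_inv_succ (by simpa [finiteTrace, K] using h hK)

theorem not_finiteTrace_subset_stable : ¬ finiteTrace ⊆ stable := by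
  intro h
  -- Rank one: K i j = 1 / ((i + 1) (j + 1)), whose section at 0 is the harmonic sequence.
  let K : PSDKernel := ⟨_, posSemidef_gram_of_family fun i : ℕ => ((i : ℝ) + 1)⁻¹⟩
  have hK : K ∈ finiteTrace := by
    simpa [finiteTrace, K, Matrix.gram_apply] using summable_inv_succ_sq
  have hs := h hK (K.kernelSection 0)
  simp only [kernelSection_apply] at hs
  refine not_summable_inv_succ (hs.congr fun i => ?_)
  simp only [K, Matrix.gram_apply]
  simp
  positivity

/-- Pythagoras bounds the signed sums of each orthogonal family; the parallelogram law bounds those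
of `a + b`, with no condition relating `a` to `b`. -/
theorem gram_mem_stable_of_add {E : Type*} [NormedAddCommGroup E] [InnerProductSpace ℝ E]
    {a b : ℕ → E} (ha : Pairwise fun i j => ⟪a i, a j⟫_ℝ = 0)
    (hb : Pairwise fun i j => ⟪b i, b j⟫_ℝ = 0) (hsa : Summable fun i => ‖a i‖ ^ 2)
    (hsb : Summable fun i => ‖b i‖ ^ 2) :
    (⟨_, posSemidef_gram_of_family fun i => a i + b i⟩ : PSDKernel) ∈ stable := by
  refine mem_stable_of_bound (2 * (∑' i, ‖a i‖ ^ 2) + 2 * ∑' i, ‖b i‖ ^ 2) fun s ε hε => ?_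
  have hq : ∑ i ∈ s, ∑ j ∈ s, ε i * ε j * Matrix.gram ℝ (fun i => a i + b i) i j
      = ‖∑ i ∈ s, ε i • (a i + b i)‖ ^ 2 := (norm_sum_smul_sq s ε _).symm
  have hbound : ∀ c : ℕ → E, (Pairwise fun i j => ⟪c i, c j⟫_ℝ = 0) →
      (Summable fun i => ‖c i‖ ^ 2) → ‖∑ i ∈ s, ε i • c i‖ ^ 2 ≤ ∑' i, ‖c i‖ ^ 2 := by
    intro c hc hsc
    rw [norm_sum_sq_of_pairwise_orthogonal hc]
    refine le_trans (Finset.sum_le_sum fun i _ => ?_)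
      (Summable.sum_le_tsum s (fun _ _ => sq_nonneg _) hsc)
    exact mul_le_of_le_one_left (sq_nonneg _) ((sq_le_one_iff_abs_le_one _).2 (hε i))
  refine hq.trans_le ?_
  simp only [smul_add, Finset.sum_add_distrib]
  have h1 := hbound a ha hsa
  have h2 := hbound b hb hsb
  have h3 := parallelogram_law_with_norm ℝ (∑ i ∈ s, ε i • a i) (∑ i ∈ s, ε i • b i)
  nlinarith [norm_nonneg (∑ i ∈ s, ε i • a i - ∑ i ∈ s, ε i • b i)]

end PSDKernel

/-! ### Walsh–Hadamard blocks: a stable kernel that is not absolutely summable -/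

/-- The Walsh–Hadamard matrix on the Boolean cube, with entries `(-1) ^ #{k | a k ∧ b k}`. -/
def walsh {n : ℕ} (a b : Fin n → Bool) : ℝ := ∏ k, if a k && b k then -1 else 1

theorem abs_walsh {n : ℕ} (a b : Fin n → Bool) : |walsh a b| = 1 := by
  rw [walsh, Finset.abs_prod]
  exact Finset.prod_eq_one fun k _ => by split_ifs <;> simp

/-- The sum factors over coordinates, and a coordinate where `b` and `c` differ contributes 1 + (-1)
= 0. -/
theorem sum_walsh_mul_walsh {n : ℕ} (b c : Fin n → Bool) :
    ∑ a, walsh a b * walsh a c = if b = c then 2 ^ n else 0 := by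
  have h : ∑ a, walsh a b * walsh a c
      = ∏ k, ∑ t : Bool, (if t && b k then (-1 : ℝ) else 1) * if t && c k then -1 else 1 := by
    rw [Finset.prod_univ_sum, Fintype.piFinset_univ]
    exact Finset.sum_congr rfl fun a _ => by rw [walsh, walsh, ← Finset.prod_mul_distrib]
  rw [h]
  split_ifs with hbc
  · subst hbc
    rw [Finset.prod_eq_pow_card (b := (2 : ℝ)), Finset.card_univ, Fintype.card_fin]
    intro k _
    cases hb : b k <;> norm_num
  · obtain ⟨k, hk⟩ := Function.ne_iff.1 hbc
    refine Finset.prod_eq_zero (Finset.mem_univ k) ?_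
    revert hk
    cases b k <;> cases c k <;> simp

/-- Disjoint union of the Boolean cubes of dimensions `4 m`. -/
abbrev Cubes : Type := Σ m : ℕ, (Fin (4 * m) → Bool)

section

variable {E : Type*} [NormedAddCommGroup E] [InnerProductSpace ℝ E]

/-- The blockwise Walsh–Hadamard transform of a family of vectors indexed by `Cubes`. -/
noncomputable def walshFamily (e : Cubes → E) (x : Cubes) : E :=
  ((4 : ℝ) ^ x.1)⁻¹ • ∑ a, walsh a x.2 • e ⟨x.1, a⟩

theorem inner_walshFamily {e : Cubes → E} (he : Orthonormal ℝ e) (m : ℕ)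
    (a b : Fin (4 * m) → Bool) :
    ⟪e ⟨m, a⟩, walshFamily e ⟨m, b⟩⟫_ℝ = ((4 : ℝ) ^ m)⁻¹ * walsh a b := by
  simp only [walshFamily, inner_sum, real_inner_smul_right, orthonormal_iff_ite.1 he]
  simp

theorem orthonormal_walshFamily {e : Cubes → E} (he : Orthonormal ℝ e) :
    Orthonormal ℝ (walshFamily e) := by
  rw [orthonormal_iff_ite]
  rintro ⟨m, b⟩ ⟨l, c⟩
  by_cases hml : m = l
  · subst hml
    have h1 : ⟪walshFamily e ⟨m, b⟩, walshFamily e ⟨m, c⟩⟫_ℝ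
        = ((4 : ℝ) ^ m)⁻¹ * (((4 : ℝ) ^ m)⁻¹ * ∑ a, walsh a b * walsh a c) := by
      conv_lhs => rw [walshFamily]
      simp only [sum_inner, real_inner_smul_left, inner_walshFamily he, Finset.mul_sum]
      exact Finset.sum_congr rfl fun a _ => by ring
    rw [h1, sum_walsh_mul_walsh]
    -- Dimension 4m gives the block 16^m points, so the normalization 4^m is an exact square root.
    have h2 : ((2 : ℝ) ^ (4 * m)) = 4 ^ m * 4 ^ m := by
      rw [← mul_pow, pow_mul]
      norm_num
    by_cases hbc : b = c
    · simp only [hbc, if_true, h2]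
      field_simp
    · simp [hbc]
  · have h0 : ∀ a a', ⟪e ⟨m, a⟩, e ⟨l, a'⟩⟫_ℝ = 0 := fun a a' =>
      he.2 fun h => hml (Sigma.mk.inj_iff.1 h).1
    simp [walshFamily, sum_inner, inner_sum, real_inner_smul_left, real_inner_smul_right, h0, hml]

end

/-- Block m contributes 16^m / 64^m = 4^(-m). -/
theorem summable_cubes_weight : Summable fun x : Cubes => (((8 : ℝ) ^ x.1)⁻¹) ^ 2 := by
  refine (summable_sigma_of_nonneg fun _ => sq_nonneg _).2 ⟨fun m => .of_finite, ?_⟩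
  refine (summable_geometric_of_lt_one (r := (1 / 4 : ℝ)) (by norm_num) (by norm_num)).congr
    fun m => ?_
  simp only [tsum_fintype, Finset.sum_const, Finset.card_univ, Fintype.card_fun, Fintype.card_bool,
    Fintype.card_fin, nsmul_eq_mul]
  push_cast
  rw [pow_mul, ← inv_pow, pow_right_comm _ m 2, ← mul_pow]
  norm_num

namespace PSDKernel

theorem not_stable_subset_absSummable : ¬ stable ⊆ absSummable := by
  intro h
  obtain ⟨φ⟩ : Nonempty (ℕ ≃ Cubes ⊕ Cubes) := inferInstance
  let e : Cubes → lp (fun _ : Cubes => ℝ) 2 :=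
    (HilbertBasis.ofRepr (LinearIsometryEquiv.refl ℝ _) : HilbertBasis Cubes ℝ _)
  have he : Orthonormal ℝ e := HilbertBasis.orthonormal _
  let w : Cubes → ℝ := fun x => ((8 : ℝ) ^ x.1)⁻¹
  have hw : ∀ x, 0 ≤ w x := fun x => by positivity
  have hu := orthonormal_walshFamily he
  -- Supported on different summands, `a` and `b` add up to the list of both weighted bases.
  let a : Cubes ⊕ Cubes → lp (fun _ : Cubes => ℝ) 2 := Sum.elim (fun x => w x • e x) 0
  let b : Cubes ⊕ Cubes → lp (fun _ : Cubes => ℝ) 2 :=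
    Sum.elim 0 fun x => w x • walshFamily e x
  have horth : ∀ {g : Cubes → lp (fun _ : Cubes => ℝ) 2}, Orthonormal ℝ g →
      ∀ x y, x ≠ y → ⟪w x • g x, w y • g y⟫_ℝ = 0 := fun hg x y hxy => by
    rw [real_inner_smul_left, real_inner_smul_right, hg.2 hxy, mul_zero, mul_zero]
  have ha : Pairwise fun x y => ⟪a x, a y⟫_ℝ = 0 := by
    rintro (x | x) (y | y) hxy
    · exact horth he x y fun h => hxy (congrArg _ h)
    all_goals simp [a]
  have hb : Pairwise fun x y => ⟪b x, b y⟫_ℝ = 0 := by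
    rintro (x | x) (y | y) hxy
    on_goal 4 => exact horth hu x y fun h => hxy (congrArg _ h)
    all_goals simp [b]
  have hnorm : ∀ {g : Cubes → lp (fun _ : Cubes => ℝ) 2}, Orthonormal ℝ g →
      Summable fun x => ‖w x • g x‖ ^ 2 := fun hg => by
    refine summable_cubes_weight.congr fun x => ?_
    rw [norm_smul, hg.1, mul_one, Real.norm_of_nonneg (hw x)]
  have hsa : Summable fun x => ‖a x‖ ^ 2 :=
    Summable.sum _ (hnorm he) (by simp [a, Function.comp_def])
  have hsb : Summable fun x => ‖b x‖ ^ 2 :=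
    Summable.sum _ (by simp [b, Function.comp_def]) (hnorm hu)
  have hK := h (gram_mem_stable_of_add (a := a ∘ φ) (b := b ∘ φ) (ha.comp_of_injective φ.injective)
    (hb.comp_of_injective φ.injective) (φ.summable_iff.2 hsa) (φ.summable_iff.2 hsb))
  -- Only cross entries within a block are needed: 256^m of them, each of size 8^(-m) · 8^(-m) ·
  -- 4^(-m) = 256^(-m), so every block sums to 1.
  let j : (Σ m : ℕ, (Fin (4 * m) → Bool) × (Fin (4 * m) → Bool)) → ℕ × ℕ := fun q =>
    (φ.symm (.inl ⟨q.1, q.2.1⟩), φ.symm (.inr ⟨q.1, q.2.2⟩))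
  have hj : Function.Injective j := by
    rintro ⟨m, x, y⟩ ⟨l, x', y'⟩ hq
    simp only [j, Prod.mk.injEq, EmbeddingLike.apply_eq_iff_eq, Sum.inl.injEq, Sum.inr.injEq,
      Sigma.mk.injEq] at hq
    obtain ⟨⟨rfl, hx⟩, -, hy⟩ := hq
    rw [eq_of_heq hx, eq_of_heq hy]
  have hs : Summable fun q : Σ m : ℕ, (Fin (4 * m) → Bool) × (Fin (4 * m) → Bool) =>
      ((256 : ℝ) ^ q.1)⁻¹ := by
    refine (hK.comp_injective hj).congr fun q => ?_
    obtain ⟨m, x, y⟩ := q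
    have h256 : (256 : ℝ) = 8 * (8 * 4) := by norm_num
    simp only [Function.comp_apply, Matrix.gram_apply, j, Equiv.apply_symm_apply, a, b, w,
      Sum.elim_inl, Sum.elim_inr, Pi.zero_apply, add_zero, zero_add, real_inner_smul_left,
      real_inner_smul_right, inner_walshFamily he, abs_mul, abs_walsh, abs_inv, abs_pow, mul_one]
    rw [h256, mul_pow, mul_pow, mul_inv, mul_inv]
    norm_num
  have ht := ((summable_sigma_of_nonneg fun _ => by positivity).1 hs).2
  have hone : ∀ m : ℕ,
      ∑' _ : (Fin (4 * m) → Bool) × (Fin (4 * m) → Bool), ((256 : ℝ) ^ m)⁻¹ = 1 := by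
    intro m
    simp only [tsum_fintype, Finset.sum_const, Finset.card_univ, Fintype.card_prod,
      Fintype.card_fun, Fintype.card_bool, Fintype.card_fin, nsmul_eq_mul]
    push_cast
    rw [pow_mul, ← mul_pow]
    norm_num
  simp only [hone] at ht
  exact one_ne_zero ((summable_const_iff _).1 ht)

end PSDKernel

theorem theorem2 :
    PSDKernel.absSummable ⊂ PSDKernel.stable ∧
    PSDKernel.stable ⊂ PSDKernel.finiteTrace ∧
    PSDKernel.finiteTrace ⊂ PSDKernel.sqSummable :=
  ⟨⟨PSDKernel.absSummable_subset_stable, PSDKernel.not_stable_subset_absSummable⟩,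
    ⟨PSDKernel.stable_subset_finiteTrace, PSDKernel.not_finiteTrace_subset_stable⟩,
    ⟨PSDKernel.finiteTrace_subset_sqSummable, PSDKernel.not_sqSummable_subset_finiteTrace⟩⟩
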